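/- Let $-\infty<a<b<\infty$ and let $p,q,r:(a,b)\to\mathbb{R}$ satisfy $r>0$ and $p>0$ a.e. on $(a,b)$ and $r,\,1/p,\,q\in L^1((a,b);dx)$. Write $g^{[1]}=pg'$ for the quasi-derivative and $\tau g=\frac1r\left[-(g^{[1]})'+qg\right]$. In the Hilbert space $L^2((a,b);r\,dx)$ of complex-valued functions let $H_{\max}f=\tau f$ on $$\operatorname{dom}(H_{\max})=\{g\in L^2((a,b);r\,dx)\mid g,g^{[1]}\in AC([a,b]),\ \tau g\in L^2((a,b);r\,dx)\},$$ and let $H_{\min}$ be the restriction of $H_{\max}$ to those $g$ with $g(a)=g^{[1]}(a)=g(b)=g^{[1]}(b)=0$. For $g\in\operatorname{dom}(H_{\max})$ put $$\gamma_Dg=\begin{pmatrix}g(a)\\ g(b)\end{pmatrix},\qquad \gamma_Ng=\begin{pmatrix}g^{[1]}(a)\\ -g^{[1]}(b)\end{pmatrix}.$$ For $U\in\mathbb{C}^{2\times2}$ unitary let $H_U$ be the restriction of $H_{\max}$ to $\{g\in\operatorname{dom}(H_{\max})\mid i(U-I_2)\gamma_Dg=(U+I_2)\gamma_Ng\}$.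 For $X_D,X_N\in\mathbb{C}^{2\times2}$ with $$\operatorname{rank}(X_D\ \ X_N)=2,\qquad X_DX_N^*=X_NX_D^*,\qquad(*)$$ let $\widetilde H_{X_D,X_N}$ be the restriction of $H_{\max}$ to $\{g\in\operatorname{dom}(H_{\max})\mid X_D\gamma_Dg+X_N\gamma_Ng=0\}$. Then the following hold. (i) A symmetric extension $H$ of $H_{\min}$ is self-adjoint if and only if $H=H_U$ for some unitary $U\in\mathbb{C}^{2\times2}$. (ii) For every unitary $U\in\mathbb{C}^{2\times2}$, the matrices $X_{D,U}=\frac i2(I_2-U)$ and $X_{N,U}=\frac12(U+I_2)$ satisfy $(*)$, and $H_U=\widetilde H_{X_{D,U},X_{N,U}}$. Moreover, $X_{D,U}+iX_{N,U}$ is invertible and $U=(X_{D,U}+iX_{N,U})^{-1}(iX_{N,U}-X_{D,U})$. (iii) For all $X_D,X_N\in\mathbb{C}^{2\times2}$ satisfying $(*)$, $\widetilde H_{X_D,X_N}$ is a self-adjoint extension of $H_{\min}$, the matrix $X_D+iX_N$ is invertible, the matrix $U_{X_D,X_N}=(X_D+iX_N)^{-1}(iX_N-X_D)$ is unitary, and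 $\widetilde H_{X_D,X_N}=H_{U_{X_D,X_N}}$. (iv) For unitary $U,U'\in\mathbb{C}^{2\times2}$, $H_U=H_{U'}$ if and only if $U=U'$. The mapping $U\mapsto H_U$ is a bijection from the unitary $2\times2$ matrices onto the set of all self-adjoint extensions of $H_{\min}$. -/

import Mathlib

noncomputable section

namespace SturmLiouville

open MeasureTheory Set

/-- Standing assumptions on the coefficients of a regular Sturm--Liouville expression on the
bounded interval `(a, b)`: `p, r > 0` a.e., `q` real-valued, and `r, 1/p, q ∈ L¹((a,b); dx)`. -/
structure Hypothesis (a b : ℝ) (p q r : ℝ → ℝ) : Prop where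
  lt : a < b
  r_pos : ∀ᵐ x ∂(volume.restrict (Ioo a b)), 0 < r x
  r_int : IntegrableOn r (Ioo a b)
  p_pos : ∀ᵐ x ∂(volume.restrict (Ioo a b)), 0 < p x
  p_inv_int : IntegrableOn (fun x => 1 / p x) (Ioo a b)
  q_int : IntegrableOn q (Ioo a b)

/-- The measure `r dx` on `(a, b)`. -/
def weight (a b : ℝ) (r : ℝ → ℝ) : Measure ℝ :=
  (volume.restrict (Ioo a b)).withDensity (fun x => ENNReal.ofReal (r x))

/-- The Hilbert space `L²((a,b); r dx)` of complex-valued functions. -/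
abbrev L2 (a b : ℝ) (r : ℝ → ℝ) : Type := Lp ℂ 2 (weight a b r)

/-- `τ u = (1/r) (-(u^{[1]})' + q u)`, where `v` is the (absolutely continuous version of the)
first quasi-derivative `u^{[1]} = p u'`. -/
def tauExpr (q r : ℝ → ℝ) (u v : ℝ → ℂ) (x : ℝ) : ℂ :=
  (1 / (r x : ℂ)) * (-(deriv v x) + (q x : ℂ) * u x)

/-- `f ∈ L²((a,b); r dx)` satisfies the conditions of the maximal domain: it is represented by
`u ∈ AC([a,b])`, its quasi-derivative `p u'` is represented by `v ∈ AC([a,b])`, and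
`τ u ∈ L²((a,b); r dx)`. -/
structure IsRep (a b : ℝ) (p q r : ℝ → ℝ) (f : L2 a b r) (u v : ℝ → ℂ) : Prop where
  ae_eq : f =ᵐ[weight a b r] u
  ac : AbsolutelyContinuousOnInterval u a b
  ac_quasi : AbsolutelyContinuousOnInterval v a b
  quasi_eq : ∀ᵐ x ∂(volume.restrict (Ioo a b)), v x = (p x : ℂ) * deriv u x
  tau_mem : MemLp (tauExpr q r u v) 2 (weight a b r)

section helpers

variable {a b : ℝ} {p q r : ℝ → ℝ}

lemma weight_ae_of_ae {P : ℝ → Prop} (h : ∀ᵐ x ∂(volume.restrict (Ioo a b)), P x) :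
    ∀ᵐ x ∂(weight a b r), P x :=
  (withDensity_absolutelyContinuous _ _).ae_le h

lemma ae_of_weight_ae (hyp : Hypothesis a b p q r) {P : ℝ → Prop}
    (h : ∀ᵐ x ∂(weight a b r), P x) : ∀ᵐ x ∂(volume.restrict (Ioo a b)), P x := by
  refine (withDensity_absolutelyContinuous' ?_ ?_).ae_le h
  · exact hyp.r_int.aestronglyMeasurable.aemeasurable.ennreal_ofReal
  · filter_upwards [hyp.r_pos] with x hx
    simpa using hx

lemma ac_ae_differentiableAt {u : ℝ → ℂ} (hu : AbsolutelyContinuousOnInterval u a b) :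
    ∀ᵐ x ∂(volume.restrict (Ioo a b)), DifferentiableAt ℝ u x := by
  rw [ae_restrict_iff' measurableSet_Ioo]
  filter_upwards [hu.boundedVariationOn.ae_differentiableAt_of_mem_uIcc] with x hx hxab
  exact hx (Icc_subset_uIcc (Ioo_subset_Icc_self hxab))

lemma eqOn_of_ac (hab : a < b) {u₁ u₂ : ℝ → ℂ} (h₁ : AbsolutelyContinuousOnInterval u₁ a b)
    (h₂ : AbsolutelyContinuousOnInterval u₂ a b)
    (h : ∀ᵐ x ∂(volume.restrict (Ioo a b)), u₁ x = u₂ x) : EqOn u₁ u₂ (Icc a b) := by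
  have c₁ := h₁.continuousOn
  have c₂ := h₂.continuousOn
  rw [uIcc_of_le hab.le] at c₁ c₂
  refine Measure.eqOn_Icc_of_ae_eq (μ := volume) hab.ne ?_ c₁ c₂
  rw [← restrict_Ioo_eq_restrict_Icc]
  exact h

lemma deriv_eqOn_of_eqOn {u₁ u₂ : ℝ → ℂ} (h : EqOn u₁ u₂ (Icc a b)) :
    EqOn (deriv u₁) (deriv u₂) (Ioo a b) := fun _ hx =>
  Filter.EventuallyEq.deriv_eq (Filter.eventuallyEq_of_mem (Icc_mem_nhds hx.1 hx.2) h)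

lemma IsRep.unique (hyp : Hypothesis a b p q r) {f : L2 a b r} {u₁ v₁ u₂ v₂ : ℝ → ℂ}
    (h₁ : IsRep a b p q r f u₁ v₁) (h₂ : IsRep a b p q r f u₂ v₂) :
    EqOn u₁ u₂ (Icc a b) ∧ EqOn v₁ v₂ (Icc a b) := by
  have hu : EqOn u₁ u₂ (Icc a b) := by
    refine eqOn_of_ac hyp.lt h₁.ac h₂.ac (ae_of_weight_ae hyp ?_)
    filter_upwards [h₁.ae_eq, h₂.ae_eq] with x e₁ e₂
    rw [← e₁, e₂]
  refine ⟨hu, eqOn_of_ac hyp.lt h₁.ac_quasi h₂.ac_quasi ?_⟩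
  filter_upwards [h₁.quasi_eq, h₂.quasi_eq, ae_restrict_mem measurableSet_Ioo] with x e₁ e₂ hx
  rw [e₁, e₂, deriv_eqOn_of_eqOn hu hx]

lemma IsRep.tau_ae_eq (hyp : Hypothesis a b p q r) {f : L2 a b r} {u₁ v₁ u₂ v₂ : ℝ → ℂ}
    (h₁ : IsRep a b p q r f u₁ v₁) (h₂ : IsRep a b p q r f u₂ v₂) :
    tauExpr q r u₁ v₁ =ᵐ[weight a b r] tauExpr q r u₂ v₂ := by
  obtain ⟨hu, hv⟩ := h₁.unique hyp h₂
  refine weight_ae_of_ae ?_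
  filter_upwards [ae_restrict_mem measurableSet_Ioo] with x hx
  simp only [tauExpr, deriv_eqOn_of_eqOn hv hx, hu (Ioo_subset_Icc_self hx)]

lemma tauExpr_add_ae {u₁ v₁ u₂ v₂ : ℝ → ℂ} (h₁ : AbsolutelyContinuousOnInterval v₁ a b)
    (h₂ : AbsolutelyContinuousOnInterval v₂ a b) :
    tauExpr q r (u₁ + u₂) (v₁ + v₂) =ᵐ[weight a b r] tauExpr q r u₁ v₁ + tauExpr q r u₂ v₂ := by
  refine weight_ae_of_ae ?_
  filter_upwards [ac_ae_differentiableAt h₁, ac_ae_differentiableAt h₂] with x d₁ d₂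
  simp only [tauExpr, Pi.add_apply, deriv_add d₁ d₂]
  ring

lemma tauExpr_smul (c : ℂ) (u v : ℝ → ℂ) :
    tauExpr q r (c • u) (c • v) = c • tauExpr q r u v := by
  funext x
  simp only [tauExpr, Pi.smul_apply, smul_eq_mul, deriv_const_smul_field]
  ring

lemma IsRep.add {f g : L2 a b r} {u₁ v₁ u₂ v₂ : ℝ → ℂ} (h₁ : IsRep a b p q r f u₁ v₁)
    (h₂ : IsRep a b p q r g u₂ v₂) : IsRep a b p q r (f + g) (u₁ + u₂) (v₁ + v₂) where
  ae_eq := (Lp.coeFn_add f g).trans (h₁.ae_eq.add h₂.ae_eq)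
  ac := h₁.ac.add h₂.ac
  ac_quasi := h₁.ac_quasi.add h₂.ac_quasi
  quasi_eq := by
    filter_upwards [h₁.quasi_eq, h₂.quasi_eq, ac_ae_differentiableAt h₁.ac,
      ac_ae_differentiableAt h₂.ac] with x e₁ e₂ d₁ d₂
    rw [Pi.add_apply, e₁, e₂, deriv_add d₁ d₂, mul_add]
  tau_mem := (h₁.tau_mem.add h₂.tau_mem).ae_eq (tauExpr_add_ae h₁.ac_quasi h₂.ac_quasi).symm

lemma IsRep.smul (c : ℂ) {f : L2 a b r} {u v : ℝ → ℂ} (h : IsRep a b p q r f u v) :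
    IsRep a b p q r (c • f) (c • u) (c • v) where
  ae_eq := (Lp.coeFn_smul c f).trans (h.ae_eq.const_smul c)
  ac := h.ac.const_smul c
  ac_quasi := h.ac_quasi.const_smul c
  quasi_eq := by
    filter_upwards [h.quasi_eq] with x e
    simp only [Pi.smul_apply, smul_eq_mul, e, deriv_const_smul_field]
    ring
  tau_mem := by
    rw [tauExpr_smul]
    exact h.tau_mem.const_smul c

lemma IsRep.zero : IsRep a b p q r 0 0 0 := by
  have hac : AbsolutelyContinuousOnInterval (0 : ℝ → ℂ) a b := by
    simp [absolutelyContinuousOnInterval_iff]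
    exact fun ε hε => ⟨1, one_pos, fun _ _ _ _ => hε⟩
  have htau : tauExpr q r 0 0 = 0 := by
    funext x
    simp [tauExpr]
  exact ⟨Lp.coeFn_zero _ _ _, hac, hac, by simp, by rw [htau]; exact MemLp.zero⟩

end helpers

/-- `dom(H_max) = {g ∈ L²((a,b); r dx) | g, g^{[1]} ∈ AC([a,b]), τ g ∈ L²((a,b); r dx)}`. -/
def maxDomain (a b : ℝ) (p q r : ℝ → ℝ) : Submodule ℂ (L2 a b r) where
  carrier := {f | ∃ u v : ℝ → ℂ, IsRep a b p q r f u v}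
  add_mem' := by
    rintro f g ⟨u₁, v₁, h₁⟩ ⟨u₂, v₂, h₂⟩
    exact ⟨_, _, h₁.add h₂⟩
  zero_mem' := ⟨0, 0, IsRep.zero⟩
  smul_mem' := by
    rintro c f ⟨u, v, h⟩
    exact ⟨_, _, h.smul c⟩

section operators

variable {a b : ℝ} {p q r : ℝ → ℝ}

/-- The absolutely continuous representative of `g ∈ dom(H_max)` (unique on `[a,b]`). -/
def rep (g : maxDomain a b p q r) : ℝ → ℂ := g.2.choose

/-- The absolutely continuous quasi-derivative `g^{[1]}` of `g ∈ dom(H_max)`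
(unique on `[a,b]`). -/
def quasiDeriv (g : maxDomain a b p q r) : ℝ → ℂ := g.2.choose_spec.choose

lemma isRep_rep (g : maxDomain a b p q r) :
    IsRep a b p q r (g : L2 a b r) (rep g) (quasiDeriv g) :=
  g.2.choose_spec.choose_spec

/-- The maximal operator `H_max f = τ f` in `L²((a,b); r dx)`. -/
def Hmax (hyp : Hypothesis a b p q r) : L2 a b r →ₗ.[ℂ] L2 a b r where
  domain := maxDomain a b p q r
  toFun :=
    { toFun := fun g => (isRep_rep g).tau_mem.toLp
      map_add' := by
        intro f g
        rw [← MemLp.toLp_add]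
        refine MemLp.toLp_congr _ _ ?_
        exact ((isRep_rep (f + g)).tau_ae_eq hyp ((isRep_rep f).add (isRep_rep g))).trans
          (tauExpr_add_ae (isRep_rep f).ac_quasi (isRep_rep g).ac_quasi)
      map_smul' := by
        intro c g
        rw [RingHom.id_apply, ← MemLp.toLp_const_smul]
        refine MemLp.toLp_congr _ _ ?_
        rw [← tauExpr_smul]
        exact (isRep_rep (c • g)).tau_ae_eq hyp ((isRep_rep g).smul c) }

lemma rep_quasiDeriv_eqOn (hyp : Hypothesis a b p q r) {g : maxDomain a b p q r} {u v : ℝ → ℂ}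
    (h : IsRep a b p q r (g : L2 a b r) u v) {x : ℝ} (hx : x ∈ Icc a b) :
    rep g x = u x ∧ quasiDeriv g x = v x :=
  ⟨((isRep_rep g).unique hyp h).1 hx, ((isRep_rep g).unique hyp h).2 hx⟩

/-- The Dirichlet trace `γ_D g = (g(a), g(b))`. -/
def gammaD (hyp : Hypothesis a b p q r) : maxDomain a b p q r →ₗ[ℂ] (Fin 2 → ℂ) where
  toFun g := ![rep g a, rep g b]
  map_add' f g := by
    have h := (isRep_rep f).add (isRep_rep g)
    rw [(rep_quasiDeriv_eqOn (g := f + g) hyp h (left_mem_Icc.2 hyp.lt.le)).1,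
      (rep_quasiDeriv_eqOn (g := f + g) hyp h (right_mem_Icc.2 hyp.lt.le)).1]
    simp
  map_smul' c g := by
    have h := (isRep_rep g).smul c
    rw [(rep_quasiDeriv_eqOn (g := c • g) hyp h (left_mem_Icc.2 hyp.lt.le)).1,
      (rep_quasiDeriv_eqOn (g := c • g) hyp h (right_mem_Icc.2 hyp.lt.le)).1]
    simp

/-- The Neumann trace `γ_N g = (g^{[1]}(a), -g^{[1]}(b))`. -/
def gammaN (hyp : Hypothesis a b p q r) : maxDomain a b p q r →ₗ[ℂ] (Fin 2 → ℂ) where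
  toFun g := ![quasiDeriv g a, -quasiDeriv g b]
  map_add' f g := by
    have h := (isRep_rep f).add (isRep_rep g)
    rw [(rep_quasiDeriv_eqOn (g := f + g) hyp h (left_mem_Icc.2 hyp.lt.le)).2,
      (rep_quasiDeriv_eqOn (g := f + g) hyp h (right_mem_Icc.2 hyp.lt.le)).2]
    simp [add_comm]
  map_smul' c g := by
    have h := (isRep_rep g).smul c
    rw [(rep_quasiDeriv_eqOn (g := c • g) hyp h (left_mem_Icc.2 hyp.lt.le)).2,
      (rep_quasiDeriv_eqOn (g := c • g) hyp h (right_mem_Icc.2 hyp.lt.le)).2]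
    simp

/-- The restriction of `H_max` to the domain `{g ∈ dom(H_max) | g ∈ S}`. -/
def restrictMax (hyp : Hypothesis a b p q r) (S : Submodule ℂ (maxDomain a b p q r)) :
    L2 a b r →ₗ.[ℂ] L2 a b r where
  domain := S.map (maxDomain a b p q r).subtype
  toFun := (Hmax hyp).toFun ∘ₗ Submodule.inclusion (Submodule.map_subtype_le _ S)

/-- The minimal operator: `H_max` restricted to
`{g ∈ dom(H_max) | g(a) = g^{[1]}(a) = g(b) = g^{[1]}(b) = 0}`. -/
def Hmin (hyp : Hypothesis a b p q r) : L2 a b r →ₗ.[ℂ] L2 a b r :=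
  restrictMax hyp
    { carrier := {g | rep g a = 0 ∧ quasiDeriv g a = 0 ∧ rep g b = 0 ∧ quasiDeriv g b = 0}
      add_mem' := by
        rintro f g ⟨f₁, f₂, f₃, f₄⟩ ⟨g₁, g₂, g₃, g₄⟩
        have h := (isRep_rep f).add (isRep_rep g)
        have ha := rep_quasiDeriv_eqOn (g := f + g) hyp h (left_mem_Icc.2 hyp.lt.le)
        have hb := rep_quasiDeriv_eqOn (g := f + g) hyp h (right_mem_Icc.2 hyp.lt.le)
        simp [ha.1, ha.2, hb.1, hb.2, f₁, f₂, f₃, f₄, g₁, g₂, g₃, g₄]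
      zero_mem' := by
        have h : IsRep a b p q r ((0 : maxDomain a b p q r) : L2 a b r) 0 0 := IsRep.zero
        have ha := rep_quasiDeriv_eqOn hyp h (left_mem_Icc.2 hyp.lt.le)
        have hb := rep_quasiDeriv_eqOn hyp h (right_mem_Icc.2 hyp.lt.le)
        simp [ha.1, ha.2, hb.1, hb.2]
      smul_mem' := by
        rintro c g ⟨g₁, g₂, g₃, g₄⟩
        have h := (isRep_rep g).smul c
        have ha := rep_quasiDeriv_eqOn (g := c • g) hyp h (left_mem_Icc.2 hyp.lt.le)
        have hb := rep_quasiDeriv_eqOn (g := c • g) hyp h (right_mem_Icc.2 hyp.lt.le)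
        simp [ha.1, ha.2, hb.1, hb.2, g₁, g₂, g₃, g₄] }

/-- The restriction of `H_max` to `{g ∈ dom(H_max) | X_D γ_D g + X_N γ_N g = 0}`. -/
def HX (hyp : Hypothesis a b p q r) (XD XN : Matrix (Fin 2) (Fin 2) ℂ) :
    L2 a b r →ₗ.[ℂ] L2 a b r :=
  restrictMax hyp
    { carrier := {g | XD.mulVec (gammaD hyp g) + XN.mulVec (gammaN hyp g) = 0}
      add_mem' := by
        intro f g (hf : _ + _ = _) (hg : _ + _ = _)
        simp only [mem_ofPred_eq, map_add, Matrix.mulVec_add]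
        rw [add_add_add_comm, hf, hg, add_zero]
      zero_mem' := by simp
      smul_mem' := by
        intro c g (hg : _ + _ = _)
        simp only [mem_ofPred_eq, map_smul, Matrix.mulVec_smul]
        rw [← smul_add, hg, smul_zero] }

/-- The restriction `H_U` of `H_max` to
`{g ∈ dom(H_max) | i (U - I₂) γ_D g = (U + I₂) γ_N g}`. -/
def HU (hyp : Hypothesis a b p q r) (U : Matrix (Fin 2) (Fin 2) ℂ) :
    L2 a b r →ₗ.[ℂ] L2 a b r :=
  restrictMax hyp
    { carrier := {g | (Complex.I • (U - 1)).mulVec (gammaD hyp g) = (U + 1).mulVec (gammaN hyp g)}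
      add_mem' := by
        intro f g (hf : _ = _) (hg : _ = _)
        simp only [mem_ofPred_eq, map_add, Matrix.mulVec_add]
        rw [hf, hg]
      zero_mem' := by simp
      smul_mem' := by
        intro c g (hg : _ = _)
        simp only [mem_ofPred_eq, map_smul, Matrix.mulVec_smul]
        rw [hg] }

end operators

/-- `H` is symmetric: `H ⊆ H*`. -/
def IsSymmetricOp {a b : ℝ} {r : ℝ → ℝ} (H : L2 a b r →ₗ.[ℂ] L2 a b r) : Prop :=
  H ≤ H.adjoint

/-- The conditions `rank (X_D X_N) = 2` and `X_D X_N* = X_N X_D*`. -/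
def Admissible (XD XN : Matrix (Fin 2) (Fin 2) ℂ) : Prop :=
  (Matrix.fromCols XD XN).rank = 2 ∧ XD * XN.conjTranspose = XN * XD.conjTranspose

/-- `X_{D,U} = (i/2) (I₂ - U)`. -/
def XDU (U : Matrix (Fin 2) (Fin 2) ℂ) : Matrix (Fin 2) (Fin 2) ℂ := (Complex.I / 2) • (1 - U)

/-- `X_{N,U} = (1/2) (U + I₂)`. -/
def XNU (U : Matrix (Fin 2) (Fin 2) ℂ) : Matrix (Fin 2) (Fin 2) ℂ := (1 / 2 : ℂ) • (U + 1)

/-- `(X_D + i X_N)⁻¹ (i X_N - X_D)`. -/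
def UX (XD XN : Matrix (Fin 2) (Fin 2) ℂ) : Matrix (Fin 2) (Fin 2) ℂ :=
  (XD + Complex.I • XN)⁻¹ * (Complex.I • XN - XD)

end SturmLiouville

end

noncomputable section

namespace SturmLiouville

open MeasureTheory Set Filter Topology
open scoped BoundedContinuousFunction NNReal ComplexConjugate InnerProductSpace ComplexOrder

/-! ### Carathéodory theory for Lipschitz systems with integrable constants -/

section Caratheodory

variable {E : Type*} [NormedAddCommGroup E] [NormedSpace ℝ E]

/-! Green's formula expresses ⟨H_max f, g⟩ − ⟨f, H_max g⟩ through boundary values alone. In the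
coordinates γ_± = γ_D ± iγ_N it is, up to a nonzero constant, the difference of Euclidean products
⟨γ_+ f, γ_+ g⟩ − ⟨γ_- f, γ_- g⟩ (`inner_maxOp_eq_inner_maxOp_iff`). Since (γ_+, γ_-) maps dom(H_max)
onto ℂ² × ℂ² and vanishes exactly on dom(H_min), self-adjoint extensions of H_min correspond to
subspaces equal to their own complement for this form (`adjoint_restrictMax`). Such a subspace is
the graph of a unitary U: isotropy makes γ_+ g ↦ γ_- g isometric, maximality makes it defined on all
of ℂ² (`exists_eq_cayleyDomain`). The relation γ_- g = U γ_+ g is the boundary condition of H_U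
rewritten, and surjectivity of the traces makes U unique.

The analytic input is the initial value problem for τ (`exists_isRep`), a Carathéodory problem
because the coefficients are merely integrable. Inserting solutions of τψ = 0 into Green's formula
gives the rest: the adjoint of H_min lies in H_max, dom(H_min) is dense, and all boundary values
occur.

For a pair (X_D, X_N), the boundary condition reads (X_D + iX_N) γ_- g = (iX_N − X_D) γ_+ g.
Condition (*) gives A = X_D + iX_N and B = iX_N − X_D the same product AA* = BB*, of full rank, so
A⁻¹B is unitary. -/

lemma setIntegral_Iic_eq_add {f : ℝ → E} (hf : Integrable f) (c x : ℝ) :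
    ∫ t in Iic x, f t = (∫ t in Iic c, f t) + ∫ t in c..x, f t := by
  rw [← intervalIntegral.integral_Iic_sub_Iic hf.integrableOn hf.integrableOn]
  abel

lemma continuous_setIntegral_Iic {f : ℝ → E} (hf : Integrable f) :
    Continuous fun x => ∫ t in Iic x, f t := by
  rw [funext (setIntegral_Iic_eq_add hf 0)]
  exact continuous_const.add
    (intervalIntegral.continuous_primitive (fun _ _ => hf.intervalIntegrable) 0)

lemma ae_hasDerivAt_setIntegral_Iic [CompleteSpace E] {f : ℝ → E} (hf : Integrable f) :
    ∀ᵐ x, HasDerivAt (fun x => ∫ t in Iic x, f t) (f x) x := by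
  filter_upwards [_root_.LocallyIntegrable.ae_hasDerivAt_integral hf.locallyIntegrable] with x hx
  rw [funext (setIntegral_Iic_eq_add hf 0)]
  exact (hx 0).const_add _

lemma norm_setIntegral_Iic_le {f : ℝ → E} (hf : Integrable f) (x : ℝ) :
    ‖∫ t in Iic x, f t‖ ≤ ∫ t, ‖f t‖ :=
  (norm_integral_le_integral_norm _).trans
    (setIntegral_le_integral hf.norm (Eventually.of_forall fun _ => norm_nonneg _))

/-- A Gronwall-type bound: `∫_{-∞}^x w e^{K W} ≤ e^{K W(x)} / K` for `W(x) = ∫_{-∞}^x w`. -/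
lemma setIntegral_Iic_mul_exp_le {w : ℝ → ℝ} (hw : Integrable w) (hw0 : ∀ x, 0 ≤ w x)
    {K : ℝ} (hK : 0 < K) (x : ℝ)
    (hint : Integrable fun t => w t * Real.exp (K * ∫ s in Iic t, w s)) :
    ∫ t in Iic x, w t * Real.exp (K * ∫ s in Iic t, w s)
      ≤ Real.exp (K * ∫ s in Iic x, w s) / K := by
  set W : ℝ → ℝ := fun x => ∫ s in Iic x, w s with hW
  have hmono : Monotone W := fun y z hyz =>
    setIntegral_mono_set hw.integrableOn (Eventually.of_forall hw0)
      (Iic_subset_Iic.2 hyz).eventuallyLE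
  have hemono : Monotone fun t => Real.exp (K * W t) := fun y z hyz =>
    Real.exp_le_exp.2 (mul_le_mul_of_nonneg_left (hmono hyz) hK.le)
  refine le_of_tendsto (intervalIntegral_tendsto_integral_Iic x hint.integrableOn tendsto_id) ?_
  filter_upwards [eventually_le_atBot x] with c hc
  -- For a monotone function the integral of the derivative is at most the increment, so absolute
  -- continuity of e^{KW} is not needed.
  have h := (hemono.monotoneOn (uIcc c x)).intervalIntegral_deriv_mem_uIcc
  rw [uIcc_of_le (sub_nonneg.2 (hemono hc))] at h
  have hder : ∫ t in c..x, deriv (fun t => Real.exp (K * W t)) t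
      = ∫ t in c..x, K * (w t * Real.exp (K * W t)) := by
    refine intervalIntegral.integral_congr_ae ?_
    filter_upwards [ae_hasDerivAt_setIntegral_Iic hw] with t ht _
    rw [((ht.const_mul K).exp).deriv]
    ring
  rw [hder, intervalIntegral.integral_const_mul] at h
  rw [le_div_iff₀' hK]
  have := Real.exp_pos (K * W c)
  simp only [id]
  linarith [h.2]

/-- **Carathéodory existence theorem** on the whole line with initial value at `-∞`, for a right
hand side that is Lipschitz in the second variable with integrable Lipschitz constant. -/
theorem exists_eq_add_setIntegral_Iic [CompleteSpace E] {F : ℝ → E → E} {w : ℝ → ℝ}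
    (hw : Integrable w)
    (hF : ∀ x y z, ‖F x y - F x z‖ ≤ w x * ‖y - z‖)
    (hFint : ∀ y : ℝ →ᵇ E, Integrable fun x => F x (y x)) (y₀ : E) :
    ∃ y : ℝ →ᵇ E, ∀ x, y x = y₀ + ∫ t in Iic x, F t (y t) := by
  rcases subsingleton_or_nontrivial E with hE | hE
  · exact ⟨0, fun x => Subsingleton.elim _ _⟩
  have hw0 : ∀ x, 0 ≤ w x := fun x => by
    obtain ⟨y, hy⟩ := exists_ne (0 : E)
    have h := (norm_nonneg _).trans (hF x y 0)
    rw [sub_zero] at h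
    exact nonneg_of_mul_nonneg_left h (norm_pos_iff.2 hy)
  set W : ℝ → ℝ := fun x => ∫ s in Iic x, w s with hW
  have hWc : Continuous W := continuous_setIntegral_Iic hw
  have hW0 : ∀ x, 0 ≤ W x := fun x => integral_nonneg hw0
  have hW1 : ∀ x, W x ≤ ∫ s, w s := fun x =>
    setIntegral_le_integral hw (Eventually.of_forall hw0)
  set C : ℝ := Real.exp (2 * ∫ s, w s)
  have hexpC : ∀ x, ‖Real.exp (2 * W x)‖ ≤ C := fun x => by
    rw [Real.norm_of_nonneg (Real.exp_pos _).le]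
    exact Real.exp_le_exp.2 (by linarith [hW1 x])
  have hexpn : ∀ x, ‖Real.exp (-(2 * W x))‖ ≤ 1 := fun x => by
    rw [Real.norm_of_nonneg (Real.exp_pos _).le]
    exact Real.exp_le_one_iff.2 (by linarith [hW0 x])
  -- The unknown is z = e^{-2W} y, so the sup norm of z is a weighted norm of y. The rate 2 in the
  -- exponent makes the Picard map a contraction with constant 1/2 without shrinking the interval.
  let e : ℝ →ᵇ ℝ := .ofNormedAddCommGroup (fun x => Real.exp (2 * W x)) (by fun_prop) C hexpC
  let lift : (ℝ →ᵇ E) → (ℝ →ᵇ E) := fun z => e • z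
  have hlift : ∀ z x, lift z x = Real.exp (2 * W x) • z x := fun z x => rfl
  let T : (ℝ →ᵇ E) → (ℝ →ᵇ E) := fun z =>
    .ofNormedAddCommGroup
      (fun x => Real.exp (-(2 * W x)) • (y₀ + ∫ t in Iic x, F t (lift z t)))
      (by
        have := continuous_setIntegral_Iic (hFint (lift z))
        fun_prop)
      (‖y₀‖ + ∫ t, ‖F t (lift z t)‖)
      (fun x => by
        rw [norm_smul]
        refine (mul_le_of_le_one_left (norm_nonneg _) (hexpn x)).trans
          ((norm_add_le _ _).trans ?_)
        gcongr
        exact norm_setIntegral_Iic_le (hFint _) x)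
  have hT : ∀ z x, T z x = Real.exp (-(2 * W x)) • (y₀ + ∫ t in Iic x, F t (lift z t)) :=
    fun z x => rfl
  have hint : Integrable fun t => w t * Real.exp (2 * W t) :=
    hw.mul_bdd (c := C) (by fun_prop) (Eventually.of_forall hexpC)
  have hcontr : ContractingWith (1 / 2 : ℝ≥0) T := by
    refine ⟨by rw [← NNReal.coe_lt_coe]; norm_num, LipschitzWith.of_dist_le_mul fun z₁ z₂ => ?_⟩
    refine (BoundedContinuousFunction.dist_le (by positivity)).2 fun x => ?_
    rw [hT, hT, dist_eq_norm, ← smul_sub, add_sub_add_left_eq_sub,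
      ← integral_sub (hFint _).integrableOn (hFint _).integrableOn, norm_smul,
      Real.norm_of_nonneg (Real.exp_pos _).le]
    have h1 : ‖∫ t in Iic x, (F t (lift z₁ t) - F t (lift z₂ t))‖
        ≤ ∫ t in Iic x, (w t * Real.exp (2 * W t)) * dist z₁ z₂ := by
      refine norm_integral_le_of_norm_le (hint.mul_const _).integrableOn
        (Eventually.of_forall fun t => (hF _ _ _).trans ?_)
      rw [hlift, hlift, ← smul_sub, norm_smul, Real.norm_of_nonneg (Real.exp_pos _).le, mul_assoc]
      gcongr
      · exact hw0 t
      · rw [← dist_eq_norm]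
        exact BoundedContinuousFunction.dist_coe_le_dist t
    rw [integral_mul_const] at h1
    have h2 := setIntegral_Iic_mul_exp_le hw hw0 two_pos x hint
    calc Real.exp (-(2 * W x)) * ‖∫ t in Iic x, (F t (lift z₁ t) - F t (lift z₂ t))‖
        ≤ Real.exp (-(2 * W x)) * (Real.exp (2 * W x) / 2 * dist z₁ z₂) := by
          gcongr
          exact h1.trans (by gcongr)
      _ = (Real.exp (-(2 * W x)) * Real.exp (2 * W x)) / 2 * dist z₁ z₂ := by ring
      _ = _ := by
        rw [← Real.exp_add]
        simp
  refine ⟨lift (hcontr.fixedPoint T), fun x => ?_⟩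
  have h := congrArg (fun z : ℝ →ᵇ E => Real.exp (2 * W x) • z x)
    hcontr.fixedPoint_isFixedPt.eq
  simp only [hT, smul_smul, ← Real.exp_add, add_neg_cancel, Real.exp_zero, one_smul] at h
  rw [hlift, ← h]

end Caratheodory

/-! ### Absolutely continuous functions and the fundamental theorem of calculus -/

lemma absolutelyContinuousOnInterval_of_dist_le {X Y : Type*} [PseudoMetricSpace X]
    [PseudoMetricSpace Y] {f : ℝ → X} {g : ℝ → Y} {a b : ℝ}
    (hg : AbsolutelyContinuousOnInterval g a b) (h : ∀ x y, dist (f x) (f y) ≤ dist (g x) (g y)) :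
    AbsolutelyContinuousOnInterval f a b :=
  squeeze_zero (fun _ => Finset.sum_nonneg fun _ _ => dist_nonneg)
    (fun _ => Finset.sum_le_sum fun _ _ => h _ _) hg

lemma absolutelyContinuousOnInterval_setIntegral_Iic {E : Type*} [NormedAddCommGroup E]
    [NormedSpace ℝ E] {f : ℝ → E} (hf : Integrable f) (c : E) (a b : ℝ) :
    AbsolutelyContinuousOnInterval (fun x => c + ∫ t in Iic x, f t) a b := by
  have hn := hf.norm
  refine absolutelyContinuousOnInterval_of_dist_le
    (hn.intervalIntegrable.absolutelyContinuousOnInterval_intervalIntegral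
      (left_mem_uIcc (a := a) (b := b))) fun x y => ?_
  rw [dist_add_left, dist_comm, dist_comm _ (∫ v in a..y, _), dist_eq_norm, dist_eq_norm,
    intervalIntegral.integral_Iic_sub_Iic hf.integrableOn hf.integrableOn,
    intervalIntegral.integral_interval_sub_left hn.intervalIntegrable hn.intervalIntegrable]
  exact intervalIntegral.norm_integral_le_abs_integral_norm

/-- Fundamental theorem of calculus for absolutely continuous functions with values in a complete
normed space. -/
lemma intervalIntegral_eq_sub_of_absolutelyContinuous {E : Type*} [NormedAddCommGroup E]
    [NormedSpace ℝ E] [CompleteSpace E] {f g : ℝ → E} {a b : ℝ} (hab : a ≤ b)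
    (hf : AbsolutelyContinuousOnInterval f a b) (hg : IntegrableOn g (Ioo a b))
    (h : ∀ᵐ x ∂(volume.restrict (Ioo a b)), HasDerivAt f (g x) x) :
    ∫ x in Ioo a b, g x = f b - f a := by
  have hG : Integrable ((Ioo a b).indicator g) := hg.integrable_indicator measurableSet_Ioo
  have hac := hf.sub (absolutelyContinuousOnInterval_setIntegral_Iic hG 0 a b)
  -- The difference of f and the primitive of g is absolutely continuous with derivative zero a.e.,
  -- hence constant.
  obtain ⟨C, hC⟩ := hac.const_of_ae_hasDerivAt_zero (by
    rw [ae_restrict_iff' measurableSet_Ioo] at h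
    filter_upwards [h, ae_hasDerivAt_setIntegral_Iic hG,
      (Ioo_ae_eq_Icc (a := a) (b := b) (μ := volume)).mem_iff] with x h1 h2 h3 hx
    rw [uIcc_of_le hab, ← h3] at hx
    rw [indicator_of_mem hx] at h2
    simpa using (h1 hx).sub (h2.const_add 0))
  have ha := hC a left_mem_uIcc
  have hb := hC b right_mem_uIcc
  have hIa : ∫ t in Iic a, (Ioo a b).indicator g t = 0 :=
    setIntegral_eq_zero_of_forall_eq_zero fun t ht =>
      indicator_of_notMem (fun h => not_lt.2 ht h.1) _
  have hIb : ∫ t in Iic b, (Ioo a b).indicator g t = ∫ t in Ioo a b, g t := by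
    rw [setIntegral_indicator measurableSet_Ioo,
      inter_eq_self_of_subset_right fun t ht => ht.2.le]
  simp only [Pi.sub_apply, hIa, hIb] at ha hb
  rw [← ha] at hb
  simp only [zero_add, sub_zero] at hb
  rw [← hb]
  abel

/-! ### The measure r dx and the initial value problem for τ -/

variable {a b : ℝ} {p q r : ℝ → ℝ}

lemma Hypothesis.aemeasurable_density (hyp : Hypothesis a b p q r) :
    AEMeasurable (fun x => ENNReal.ofReal (r x)) (volume.restrict (Ioo a b)) :=
  hyp.r_int.aestronglyMeasurable.aemeasurable.ennreal_ofReal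

lemma Hypothesis.isFiniteMeasure_weight (hyp : Hypothesis a b p q r) :
    IsFiniteMeasure (weight a b r) :=
  isFiniteMeasure_withDensity_ofReal hyp.r_int.2

lemma integrable_weight_iff (hyp : Hypothesis a b p q r) {f : ℝ → ℂ} :
    Integrable f (weight a b r) ↔ IntegrableOn (fun x => (r x : ℂ) * f x) (Ioo a b) := by
  rw [weight, integrable_withDensity_iff_integrable_smul₀' hyp.aemeasurable_density (by simp),
    IntegrableOn]
  refine integrable_congr ?_
  filter_upwards [hyp.r_pos] with x hx
  rw [ENNReal.toReal_ofReal hx.le, Complex.real_smul]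

lemma integral_weight (hyp : Hypothesis a b p q r) (f : ℝ → ℂ) :
    ∫ x, f x ∂(weight a b r) = ∫ x in Ioo a b, (r x : ℂ) * f x := by
  rw [weight, integral_withDensity_eq_integral_toReal_smul₀ hyp.aemeasurable_density (by simp)]
  refine integral_congr_ae ?_
  filter_upwards [hyp.r_pos] with x hx
  rw [ENNReal.toReal_ofReal hx.le, Complex.real_smul]

/-- Solvability of the initial value problem `τ g = f`, `g(a) = c₀`, `g^{[1]}(a) = c₁`. -/
theorem exists_isRep (hyp : Hypothesis a b p q r) (f : L2 a b r) (c₀ c₁ : ℂ) :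
    ∃ (u v : ℝ → ℂ) (hu : MemLp u 2 (weight a b r)), IsRep a b p q r hu.toLp u v ∧
      tauExpr q r u v =ᵐ[weight a b r] f ∧ u a = c₀ ∧ v a = c₁ := by
  have := hyp.isFiniteMeasure_weight
  set P : ℝ → ℝ := (Ioo a b).indicator fun x => 1 / p x
  set Q : ℝ → ℝ := (Ioo a b).indicator q
  set h : ℝ → ℂ := (Ioo a b).indicator fun x => (r x : ℂ) * f x
  have hP : Integrable P := hyp.p_inv_int.integrable_indicator measurableSet_Ioo
  have hQ : Integrable Q := hyp.q_int.integrable_indicator measurableSet_Ioo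
  have hh : Integrable h := ((integrable_weight_iff hyp).1
    ((Lp.memLp f).integrable one_le_two)).integrable_indicator measurableSet_Ioo
  -- The first-order system u' = v/p, v' = qu − rf. Its coefficients are cut off outside (a, b), so
  -- the initial value at −∞ is still the value at a.
  let F : ℝ → ℂ × ℂ → ℂ × ℂ := fun x y => (P x • y.2, Q x • y.1 - h x)
  have hFint : ∀ y : ℝ →ᵇ ℂ × ℂ, Integrable fun x => F x (y x) := by
    intro y
    have hy : ∀ x, ‖y x‖ ≤ ‖y‖ := y.norm_coe_le_norm
    refine Integrable.prodMk ?_ (Integrable.sub ?_ hh)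
    · exact hP.smul_bdd ‖y‖ (y.continuous.snd.aestronglyMeasurable)
        (Eventually.of_forall fun x => (norm_snd_le _).trans (hy x))
    · exact hQ.smul_bdd ‖y‖ (y.continuous.fst.aestronglyMeasurable)
        (Eventually.of_forall fun x => (norm_fst_le _).trans (hy x))
  obtain ⟨y, hy⟩ := exists_eq_add_setIntegral_Iic (F := F) (w := fun x => ‖P x‖ + ‖Q x‖)
    (hP.norm.add hQ.norm) (fun x y z => by
      simp only [F, Prod.mk_sub_mk, sub_sub_sub_cancel_right, ← smul_sub]
      refine norm_prod_le_iff.2 ⟨?_, ?_⟩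
      · rw [norm_smul]
        exact mul_le_mul (le_add_of_nonneg_right (norm_nonneg _)) (norm_snd_le (y - z))
          (norm_nonneg _) (by positivity)
      · rw [norm_smul]
        exact mul_le_mul (le_add_of_nonneg_left (norm_nonneg _)) (norm_fst_le (y - z))
          (norm_nonneg _) (by positivity)) hFint (c₀, c₁)
  have hya : y a = (c₀, c₁) := by
    rw [hy, setIntegral_eq_zero_of_forall_eq_zero, add_zero]
    intro t ht
    have hn : t ∉ Ioo a b := fun h => not_lt.2 ht h.1
    simp [F, P, Q, h, indicator_of_notMem hn]
  have hac : AbsolutelyContinuousOnInterval y a b := by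
    rw [show (y : ℝ → ℂ × ℂ) = _ from funext hy]
    exact absolutelyContinuousOnInterval_setIntegral_Iic (hFint y) _ _ _
  have hderiv : ∀ᵐ x, HasDerivAt y (F x (y x)) x := by
    filter_upwards [ae_hasDerivAt_setIntegral_Iic (hFint y)] with x hx
    exact (hx.const_add (c₀, c₁)).congr_of_eventuallyEq (Eventually.of_forall hy)
  have hd1 : ∀ᵐ x ∂(volume.restrict (Ioo a b)),
      deriv (fun x => (y x).1) x = (1 / p x : ℝ) • (y x).2 := by
    filter_upwards [ae_restrict_of_ae hderiv, ae_restrict_mem measurableSet_Ioo] with x hx hxm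
    have := (hasFDerivAt_fst.comp_hasDerivAt x hx).deriv
    simpa [F, P, indicator_of_mem hxm, Function.comp_def] using this
  have hd2 : ∀ᵐ x ∂(volume.restrict (Ioo a b)),
      deriv (fun x => (y x).2) x = q x • (y x).1 - r x * f x := by
    filter_upwards [ae_restrict_of_ae hderiv, ae_restrict_mem measurableSet_Ioo] with x hx hxm
    have := (hasFDerivAt_snd.comp_hasDerivAt x hx).deriv
    simpa [F, Q, h, indicator_of_mem hxm, Function.comp_def] using this
  have htau : tauExpr q r (fun x => (y x).1) (fun x => (y x).2) =ᵐ[weight a b r] f := by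
    refine weight_ae_of_ae ?_
    filter_upwards [hd2, hyp.r_pos] with x hx hr
    have hr' : (r x : ℂ) ≠ 0 := by exact_mod_cast hr.ne'
    rw [tauExpr, hx, Complex.real_smul]
    field_simp
    ring
  have hu : MemLp (fun x => (y x).1) 2 (weight a b r) :=
    MemLp.of_bound y.continuous.fst.aestronglyMeasurable ‖y‖
      (Eventually.of_forall fun x => (norm_fst_le _).trans (y.norm_coe_le_norm x))
  refine ⟨fun x => (y x).1, fun x => (y x).2, hu, ⟨hu.coeFn_toLp, ?_, ?_, ?_,
    (Lp.memLp f).ae_eq htau.symm⟩, htau, by simp [hya], by simp [hya]⟩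
  -- The max metric on ℂ × ℂ dominates the distance in each coordinate.
  · exact squeeze_zero (fun _ => Finset.sum_nonneg fun _ _ => dist_nonneg)
      (fun _ => Finset.sum_le_sum fun _ _ => le_max_left _ _) hac
  · exact squeeze_zero (fun _ => Finset.sum_nonneg fun _ _ => dist_nonneg)
      (fun _ => Finset.sum_le_sum fun _ _ => le_max_right _ _) hac
  · filter_upwards [hd1, hyp.p_pos] with x hx hp
    have hp' : (p x : ℂ) ≠ 0 := by exact_mod_cast hp.ne'
    rw [hx, Complex.real_smul]
    push_cast
    field_simp

/-! ### The maximal operator: Green's formula, density, boundary values -/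

/-- `H_max` as a linear map on its domain. -/
def maxOp (hyp : Hypothesis a b p q r) : maxDomain a b p q r →ₗ[ℂ] L2 a b r :=
  (Hmax hyp).toFun

lemma coeFn_maxOp (hyp : Hypothesis a b p q r) (g : maxDomain a b p q r) :
    maxOp hyp g =ᵐ[weight a b r] tauExpr q r (rep g) (quasiDeriv g) :=
  (isRep_rep g).tau_mem.coeFn_toLp

lemma maxOp_apply_eq (hyp : Hypothesis a b p q r) (g : maxDomain a b p q r) {u v : ℝ → ℂ}
    (h : IsRep a b p q r (g : L2 a b r) u v) {f : L2 a b r}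
    (hf : tauExpr q r u v =ᵐ[weight a b r] f) : maxOp hyp g = f := by
  exact Lp.ext (((coeFn_maxOp hyp g).trans ((isRep_rep g).tau_ae_eq hyp h)).trans hf)

/-- `H_max` is onto, with prescribed Cauchy data at the left endpoint. -/
theorem exists_maxOp_eq (hyp : Hypothesis a b p q r) (f : L2 a b r) (c₀ c₁ : ℂ) :
    ∃ g : maxDomain a b p q r, maxOp hyp g = f ∧ gammaD hyp g 0 = c₀ ∧
      gammaN hyp g 0 = c₁ := by
  obtain ⟨u, v, hu, hrep, htau, hua, hva⟩ := exists_isRep hyp f c₀ c₁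
  refine ⟨⟨hu.toLp, u, v, hrep⟩, maxOp_apply_eq hyp _ hrep htau, ?_⟩
  have h := rep_quasiDeriv_eqOn hyp (g := ⟨hu.toLp, u, v, hrep⟩) hrep (left_mem_Icc.2 hyp.lt.le)
  exact ⟨h.1.trans hua, h.2.trans hva⟩

/-- Green's formula. -/
theorem inner_maxOp_sub_inner_maxOp (hyp : Hypothesis a b p q r) (f g : maxDomain a b p q r) :
    ⟪maxOp hyp f, (g : L2 a b r)⟫_ℂ - ⟪(f : L2 a b r), maxOp hyp g⟫_ℂ =
      star (gammaN hyp f) ⬝ᵥ gammaD hyp g - star (gammaD hyp f) ⬝ᵥ gammaN hyp g := by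
  have hf := isRep_rep f
  have hg := isRep_rep g
  have hconj : ∀ {u : ℝ → ℂ}, AbsolutelyContinuousOnInterval u a b →
      AbsolutelyContinuousOnInterval (fun x => conj (u x)) a b := fun hu =>
    absolutelyContinuousOnInterval_of_dist_le hu fun x y => (Complex.dist_conj_conj _ _).le
  -- The Lagrange bracket of f and g, whose derivative is the integrand r (conj(τf) g − conj(f) τg):
  -- the q and 1/p terms cancel because p and q are real.
  have hac := ((hconj hf.ac).fun_smul hg.ac_quasi).fun_sub ((hconj hf.ac_quasi).fun_smul hg.ac)
  have i1 := L2.integrable_inner (𝕜 := ℂ) (maxOp hyp f) (g : L2 a b r)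
  have i2 := L2.integrable_inner (𝕜 := ℂ) (f : L2 a b r) (maxOp hyp g)
  have hint := (integrable_weight_iff hyp).1 (i1.sub i2)
  simp only [Pi.sub_apply] at hint
  rw [L2.inner_def, L2.inner_def, ← integral_sub i1 i2, integral_weight hyp,
    intervalIntegral_eq_sub_of_absolutelyContinuous hyp.lt.le hac hint]
  · simp [gammaD, gammaN, dotProduct, Fin.sum_univ_two]
    ring
  · filter_upwards [ae_of_weight_ae hyp (coeFn_maxOp hyp f), ae_of_weight_ae hyp (coeFn_maxOp hyp g),
      ae_of_weight_ae hyp hf.ae_eq, ae_of_weight_ae hyp hg.ae_eq, hf.quasi_eq, hg.quasi_eq,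
      ac_ae_differentiableAt hf.ac, ac_ae_differentiableAt hg.ac,
      ac_ae_differentiableAt hf.ac_quasi, ac_ae_differentiableAt hg.ac_quasi, hyp.r_pos, hyp.p_pos]
      with x e1 e2 e3 e4 e5 e6 d1 d2 d3 d4 hr hp
    have hr' : (r x : ℂ) ≠ 0 := by exact_mod_cast hr.ne'
    have hp' : (p x : ℂ) ≠ 0 := by exact_mod_cast hp.ne'
    have hconjd : ∀ {u : ℝ → ℂ}, DifferentiableAt ℝ u x →
        HasDerivAt (fun x => conj (u x)) (conj (deriv u x)) x := fun hu =>
      (Complex.conjCLE.toContinuousLinearMap.hasFDerivAt.comp_hasDerivAt x hu.hasDerivAt)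
    convert! ((hconjd d1).fun_mul d4.hasDerivAt).fun_sub ((hconjd d3).fun_mul d2.hasDerivAt) using 1
    simp only [e1, e2, e3, e4, e5, e6, tauExpr, RCLike.inner_apply, map_mul, map_add, map_neg,
      map_div₀, map_one, Complex.conj_ofReal]
    field_simp
    ring

/-- The domain of `H_min`, as a subspace of the domain of `H_max`. -/
def minDomain (hyp : Hypothesis a b p q r) : Submodule ℂ (maxDomain a b p q r) :=
  LinearMap.ker (gammaD hyp) ⊓ LinearMap.ker (gammaN hyp)

lemma mem_minDomain (hyp : Hypothesis a b p q r) {f : maxDomain a b p q r} :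
    f ∈ minDomain hyp ↔ gammaD hyp f = 0 ∧ gammaN hyp f = 0 := by
  simp [minDomain]

lemma mem_minDomain_iff (hyp : Hypothesis a b p q r) {f : maxDomain a b p q r} :
    f ∈ minDomain hyp ↔ (gammaD hyp f 0 = 0 ∧ gammaN hyp f 0 = 0) ∧
      (gammaD hyp f 1 = 0 ∧ gammaN hyp f 1 = 0) := by
  simp only [mem_minDomain, funext_iff, Fin.forall_fin_two, Pi.zero_apply]
  tauto

/-- Solutions of `τ ψ = 0` attain all Cauchy data at the right endpoint. -/
theorem exists_maxOp_eq_zero_right (hyp : Hypothesis a b p q r) (c₀ c₁ : ℂ) :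
    ∃ ψ : maxDomain a b p q r, maxOp hyp ψ = 0 ∧ gammaD hyp ψ 1 = c₀ ∧ gammaN hyp ψ 1 = c₁ := by
  obtain ⟨ψ₁, h₁, h₁D, h₁N⟩ := exists_maxOp_eq hyp 0 1 0
  obtain ⟨ψ₂, h₂, h₂D, h₂N⟩ := exists_maxOp_eq hyp 0 0 1
  let L : ℂ × ℂ →ₗ[ℂ] maxDomain a b p q r :=
    (LinearMap.fst ℂ ℂ ℂ).smulRight ψ₁ + (LinearMap.snd ℂ ℂ ℂ).smulRight ψ₂
  have hL : ∀ c, L c = c.1 • ψ₁ + c.2 • ψ₂ := fun c => rfl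
  have hL0 : ∀ c, maxOp hyp (L c) = 0 := fun c => by simp [hL, h₁, h₂]
  let M : ℂ × ℂ →ₗ[ℂ] ℂ × ℂ :=
    ((LinearMap.proj 1 ∘ₗ gammaD hyp).prod (LinearMap.proj 1 ∘ₗ gammaN hyp)) ∘ₗ L
  have hM : ∀ c, M c = (gammaD hyp (L c) 1, gammaN hyp (L c) 1) := fun c => rfl
  -- If a solution has zero data at b, Green's formula against ψ₁ and ψ₂ leaves only terms at a,
  -- which read off its coefficients c and force them to vanish.
  have hinj : Function.Injective M := by
    rw [← LinearMap.ker_eq_bot, LinearMap.ker_eq_bot']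
    intro c hc
    rw [hM, Prod.mk_eq_zero] at hc
    have e₁ := inner_maxOp_sub_inner_maxOp hyp (L c) ψ₁
    have e₂ := inner_maxOp_sub_inner_maxOp hyp (L c) ψ₂
    simp only [hL0, h₁, h₂, inner_zero_left, inner_zero_right, dotProduct, Fin.sum_univ_two,
      Pi.star_apply, hc.1, hc.2, star_zero, zero_mul, sub_zero, add_zero] at e₁ e₂
    simp only [hL, map_add, map_smul, Pi.add_apply, Pi.smul_apply, h₁D, h₁N, h₂D, h₂N] at e₁ e₂
    simp at e₁ e₂
    exact Prod.ext e₂ (by simpa using e₁.symm)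
  obtain ⟨c, hc⟩ := (LinearMap.injective_iff_surjective.1 hinj) (c₀, c₁)
  rw [hM, Prod.mk_inj] at hc
  exact ⟨L c, hL0 c, hc.1, hc.2⟩

/-- If `⟨h, f⟩ = ⟨g, H_min f⟩` for all `f ∈ dom(H_min)`, then `g ∈ dom(H_max)` and
`H_max g = h`. -/
theorem exists_maxOp_eq_of_inner_eq (hyp : Hypothesis a b p q r) {g h : L2 a b r}
    (H : ∀ f ∈ minDomain hyp, ⟪h, (f : L2 a b r)⟫_ℂ = ⟪g, maxOp hyp f⟫_ℂ) :
    ∃ k : maxDomain a b p q r, (k : L2 a b r) = g ∧ maxOp hyp k = h := by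
  obtain ⟨k, hk, -, -⟩ := exists_maxOp_eq hyp h 0 0
  obtain ⟨ψ₁, h₁, h₁D, h₁N⟩ := exists_maxOp_eq_zero_right hyp 1 0
  obtain ⟨ψ₂, h₂, h₂D, h₂N⟩ := exists_maxOp_eq_zero_right hyp 0 1
  let S : Submodule ℂ (L2 a b r) := Submodule.span ℂ {(ψ₁ : L2 a b r), (ψ₂ : L2 a b r)}
  have : FiniteDimensional ℂ S := FiniteDimensional.span_of_finite ℂ (by simp)
  -- The kernel S of τ is finite-dimensional, so S = S^⊥⊥. For F ⊥ S, solve τf = F with zero data at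
  -- a; Green's formula against ψ₁, ψ₂ kills the data at b too, so f ∈ dom(H_min) is a legitimate
  -- test function and gives ⟨g − k, F⟩ = 0.
  have hmem : g - k ∈ S := by
    rw [← S.orthogonal_orthogonal, Submodule.mem_orthogonal]
    intro F hF
    have hψ₁ : ⟪(ψ₁ : L2 a b r), F⟫_ℂ = 0 :=
      (S.mem_orthogonal F).1 hF _ (Submodule.subset_span (by simp))
    have hψ₂ : ⟪(ψ₂ : L2 a b r), F⟫_ℂ = 0 :=
      (S.mem_orthogonal F).1 hF _ (Submodule.subset_span (by simp))
    obtain ⟨f, hf, hfD, hfN⟩ := exists_maxOp_eq hyp F 0 0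
    have e₁ := inner_maxOp_sub_inner_maxOp hyp ψ₁ f
    have e₂ := inner_maxOp_sub_inner_maxOp hyp ψ₂ f
    simp [hf, hψ₁, hψ₂, h₁, h₂, dotProduct, Fin.sum_univ_two, hfD, hfN, h₁D, h₁N, h₂D, h₂N]
      at e₁ e₂
    have hfmin : f ∈ minDomain hyp := (mem_minDomain_iff hyp).2 ⟨⟨hfD, hfN⟩, by tauto⟩
    have hγ := (mem_minDomain hyp).1 hfmin
    have e₃ := inner_maxOp_sub_inner_maxOp hyp k f
    rw [hγ.1, hγ.2, hk, H f hfmin, hf, ← inner_sub_left, dotProduct_zero, dotProduct_zero,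
      sub_zero] at e₃
    rw [← inner_conj_symm, e₃, map_zero]
  have hker : S ≤ (LinearMap.ker (maxOp hyp)).map (maxDomain a b p q r).subtype := by
    rw [Submodule.span_le]
    rintro x (rfl | rfl)
    exacts [⟨ψ₁, h₁, rfl⟩, ⟨ψ₂, h₂, rfl⟩]
  obtain ⟨n, hn, hng⟩ := hker hmem
  refine ⟨k + n, ?_, by rw [map_add, hk, LinearMap.mem_ker.1 hn, add_zero]⟩
  rw [Submodule.coe_add]
  exact eq_sub_iff_add_eq'.1 hng

/-- `H_min` is densely defined. -/
theorem dense_minDomain (hyp : Hypothesis a b p q r) :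
    Dense (((minDomain hyp).map (maxDomain a b p q r).subtype : Submodule ℂ (L2 a b r)) :
      Set (L2 a b r)) := by
  rw [Submodule.dense_iff_topologicalClosure_eq_top, Submodule.topologicalClosure_eq_top_iff,
    Submodule.eq_bot_iff]
  intro h hh
  -- A vector h orthogonal to dom(H_min) satisfies the adjoint relation with g = 0, whence h = H_max
  -- 0 = 0.
  obtain ⟨k, hk, hkh⟩ := exists_maxOp_eq_of_inner_eq hyp (g := 0) (h := h) fun f hf => by
    rw [inner_zero_left]
    exact (Submodule.mem_orthogonal' _ _).1 hh _ ⟨f, hf, rfl⟩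
  rw [← hkh, (Submodule.coe_eq_zero.1 hk), map_zero]

/-- All boundary values are attained on `dom(H_max)`. -/
theorem exists_gamma_eq (hyp : Hypothesis a b p q r) (x y : Fin 2 → ℂ) :
    ∃ g : maxDomain a b p q r, gammaD hyp g = x ∧ gammaN hyp g = y := by
  let S : Submodule ℂ (maxDomain a b p q r) :=
    LinearMap.ker (LinearMap.proj 0 ∘ₗ gammaD hyp) ⊓ LinearMap.ker (LinearMap.proj 0 ∘ₗ gammaN hyp)
  have hS : ∀ f, f ∈ S ↔ gammaD hyp f 0 = 0 ∧ gammaN hyp f 0 = 0 := fun f => by simp [S]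
  let M : maxDomain a b p q r →ₗ[ℂ] ℂ × ℂ :=
    (LinearMap.proj 1 ∘ₗ gammaD hyp).prod (LinearMap.proj 1 ∘ₗ gammaN hyp)
  have hM : ∀ f, M f = (gammaD hyp f 1, gammaN hyp f 1) := fun f => rfl
  have htop : S.map M = ⊤ := by
    by_contra hne
    obtain ⟨φ, hφ, hle⟩ := Submodule.exists_le_ker_of_lt_top _ (lt_top_iff_ne_top.2 hne)
    have hφv : ∀ c : ℂ × ℂ, φ c = c.1 * φ (1, 0) + c.2 * φ (0, 1) := fun c => by
      rw [← smul_eq_mul, ← smul_eq_mul, ← map_smul, ← map_smul, ← map_add]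
      simp
    -- The data of ψ at b encode φ: by Green's formula ⟨ψ, τf⟩ = −φ(M f) = 0 for every f with zero
    -- data at a. These τf exhaust L², so ψ = 0 and hence φ = 0.
    obtain ⟨ψ, hψ, hψD, hψN⟩ :=
      exists_maxOp_eq_zero_right hyp (-conj (φ (0, 1))) (conj (φ (1, 0)))
    have hort : ∀ F : L2 a b r, ⟪(ψ : L2 a b r), F⟫_ℂ = 0 := fun F => by
      obtain ⟨f, hf, hfD, hfN⟩ := exists_maxOp_eq hyp F 0 0
      have e := inner_maxOp_sub_inner_maxOp hyp ψ f
      have e' : φ (M f) = 0 := hle ⟨f, (hS f).2 ⟨hfD, hfN⟩, rfl⟩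
      rw [hφv, hM] at e'
      simp [hf, hψ, dotProduct, Fin.sum_univ_two, hfD, hfN, hψD, hψN] at e
      rw [← neg_eq_zero, e]
      linear_combination e'
    have hψ0 : ψ = 0 := Submodule.coe_eq_zero.1 (inner_self_eq_zero.1 (hort ψ))
    rw [hψ0, map_zero, Pi.zero_apply] at hψD hψN
    refine hφ (LinearMap.ext fun c => ?_)
    rw [hφv, (map_eq_zero _).1 hψN.symm, (map_eq_zero _).1 (neg_eq_zero.1 hψD.symm)]
    simp
  obtain ⟨f, -, hfD, hfN⟩ := exists_maxOp_eq hyp 0 (x 0) (y 0)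
  obtain ⟨g, hg, hgM⟩ : (x 1 - gammaD hyp f 1, y 1 - gammaN hyp f 1) ∈ S.map M := by
    rw [htop]; trivial
  rw [hM, Prod.mk_inj] at hgM
  have hg' := (hS g).1 hg
  refine ⟨f + g, ?_, ?_⟩ <;> ext i <;> fin_cases i <;> simp [hfD, hfN, hg', hgM]

/-! ### The boundary form in the coordinates γ_D ± iγ_N -/

/-- The boundary map `γ_D + i γ_N`. -/
def gammaPlus (hyp : Hypothesis a b p q r) : maxDomain a b p q r →ₗ[ℂ] (Fin 2 → ℂ) :=
  gammaD hyp + Complex.I • gammaN hyp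

/-- The boundary map `γ_D - i γ_N`. -/
def gammaMinus (hyp : Hypothesis a b p q r) : maxDomain a b p q r →ₗ[ℂ] (Fin 2 → ℂ) :=
  gammaD hyp - Complex.I • gammaN hyp

lemma gammaPlus_apply (hyp : Hypothesis a b p q r) (f : maxDomain a b p q r) :
    gammaPlus hyp f = gammaD hyp f + Complex.I • gammaN hyp f := rfl

lemma gammaMinus_apply (hyp : Hypothesis a b p q r) (f : maxDomain a b p q r) :
    gammaMinus hyp f = gammaD hyp f - Complex.I • gammaN hyp f := rfl

/-- The defect form of `H_max` in terms of `γ_D ± i γ_N`. -/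
def boundaryForm (hyp : Hypothesis a b p q r) (f g : maxDomain a b p q r) : ℂ :=
  star (gammaPlus hyp f) ⬝ᵥ gammaPlus hyp g - star (gammaMinus hyp f) ⬝ᵥ gammaMinus hyp g

/-- Expanding the two Euclidean products, the D–D and N–N terms cancel and the cross terms are −2i
times Green's boundary expression. -/
lemma inner_maxOp_eq_inner_maxOp_iff (hyp : Hypothesis a b p q r) (f g : maxDomain a b p q r) :
    ⟪maxOp hyp f, (g : L2 a b r)⟫_ℂ = ⟪(f : L2 a b r), maxOp hyp g⟫_ℂ ↔
      boundaryForm hyp f g = 0 := by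
  have h : boundaryForm hyp f g = -(2 * Complex.I) *
      (⟪maxOp hyp f, (g : L2 a b r)⟫_ℂ - ⟪(f : L2 a b r), maxOp hyp g⟫_ℂ) := by
    rw [inner_maxOp_sub_inner_maxOp]
    simp only [boundaryForm, gammaPlus_apply, gammaMinus_apply, dotProduct, Fin.sum_univ_two,
      Pi.star_apply, Pi.add_apply, Pi.sub_apply, Pi.smul_apply, smul_eq_mul, star_add, star_sub,
      star_mul', Complex.star_def, Complex.conj_I]
    ring
  rw [h, mul_eq_zero, sub_eq_zero, or_iff_right]
  simp

lemma boundaryForm_eq_zero_symm (hyp : Hypothesis a b p q r) {f g : maxDomain a b p q r}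
    (h : boundaryForm hyp f g = 0) : boundaryForm hyp g f = 0 := by
  rw [boundaryForm, Matrix.star_dotProduct, Matrix.star_dotProduct (gammaMinus hyp g), ← star_sub,
    star_eq_zero]
  exact h

lemma exists_gammaPlus_eq (hyp : Hypothesis a b p q r) (s d : Fin 2 → ℂ) :
    ∃ g : maxDomain a b p q r, gammaPlus hyp g = s ∧ gammaMinus hyp g = d := by
  obtain ⟨g, hD, hN⟩ := exists_gamma_eq hyp ((1 / 2 : ℂ) • (s + d))
    ((-Complex.I / 2) • (s - d))
  have hI := Complex.I_mul_I
  refine ⟨g, ?_, ?_⟩ <;> ext i <;>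
    simp only [gammaPlus_apply, gammaMinus_apply, hD, hN, Pi.add_apply, Pi.sub_apply,
      Pi.smul_apply, smul_eq_mul]
  · linear_combination (-(s i - d i) / 2) * hI
  · linear_combination ((s i - d i) / 2) * hI

lemma mem_minDomain_of_gammaPlus (hyp : Hypothesis a b p q r) {f : maxDomain a b p q r}
    (hs : gammaPlus hyp f = 0) (hd : gammaMinus hyp f = 0) : f ∈ minDomain hyp := by
  rw [mem_minDomain]
  rw [gammaMinus_apply, sub_eq_zero] at hd
  rw [gammaPlus_apply, ← hd, ← two_smul ℂ, smul_eq_zero_iff_right two_ne_zero] at hs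
  refine ⟨hs, ?_⟩
  rwa [hs, eq_comm, smul_eq_zero_iff_right Complex.I_ne_zero] at hd

/-! ### Restrictions of the maximal operator -/

lemma restrictMax_le_iff (hyp : Hypothesis a b p q r)
    {S T : Submodule ℂ (maxDomain a b p q r)} :
    restrictMax hyp S ≤ restrictMax hyp T ↔ S ≤ T := by
  refine ⟨fun h => ?_, fun h => ⟨Submodule.map_mono h, ?_⟩⟩
  · exact (Submodule.map_le_map_iff_of_injective (Submodule.subtype_injective _) S T).1 h.1
  · rintro ⟨x, hx⟩ ⟨y, hy⟩ rfl
    rfl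

lemma restrictMax_inj (hyp : Hypothesis a b p q r)
    {S T : Submodule ℂ (maxDomain a b p q r)} :
    restrictMax hyp S = restrictMax hyp T ↔ S = T :=
  ⟨fun h => le_antisymm ((restrictMax_le_iff hyp).1 h.le) ((restrictMax_le_iff hyp).1 h.ge),
    fun h => h ▸ rfl⟩

lemma restrictMax_apply (hyp : Hypothesis a b p q r) {S : Submodule ℂ (maxDomain a b p q r)}
    (f : maxDomain a b p q r) (hf : (f : L2 a b r) ∈ (restrictMax hyp S).domain) :
    restrictMax hyp S ⟨f, hf⟩ = maxOp hyp f := rfl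

lemma exists_eq_restrictMax (hyp : Hypothesis a b p q r) {H : L2 a b r →ₗ.[ℂ] L2 a b r}
    {T : Submodule ℂ (maxDomain a b p q r)} (h : H ≤ restrictMax hyp T) :
    ∃ S, H = restrictMax hyp S := by
  refine ⟨H.domain.comap (maxDomain a b p q r).subtype, ?_⟩
  have hd : H.domain = (restrictMax hyp (H.domain.comap (maxDomain a b p q r).subtype)).domain := by
    change _ = Submodule.map _ _
    rw [Submodule.map_comap_subtype, right_eq_inf]
    exact h.1.trans (Submodule.map_subtype_le _ _)
  exact LinearPMap.eq_of_le_of_domain_eq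
    ⟨hd.le, fun x y hxy => (h.2 (y := ⟨y, hxy ▸ h.1 x.2⟩) hxy).trans rfl⟩ hd

/-- The orthogonal complement of a subspace with respect to the boundary form. -/
def boundaryCompl (hyp : Hypothesis a b p q r) (S : Submodule ℂ (maxDomain a b p q r)) :
    Submodule ℂ (maxDomain a b p q r) where
  carrier := {g | ∀ f ∈ S, boundaryForm hyp g f = 0}
  add_mem' hg hh f hf := by
    have h₁ := hg f hf
    have h₂ := hh f hf
    simp only [boundaryForm, map_add, star_add, add_dotProduct] at *
    linear_combination h₁ + h₂
  zero_mem' f _ := by simp [boundaryForm]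
  smul_mem' c g hg f hf := by
    have h₁ := hg f hf
    simp only [boundaryForm, map_smul, star_smul, smul_dotProduct, ← smul_sub] at *
    rw [h₁, smul_zero]

lemma dense_restrictMax (hyp : Hypothesis a b p q r) {S : Submodule ℂ (maxDomain a b p q r)}
    (hS : minDomain hyp ≤ S) : Dense ((restrictMax hyp S).domain : Set (L2 a b r)) :=
  (dense_minDomain hyp).mono (Submodule.map_mono hS)

/-- The adjoint of a restriction of `H_max` that extends `H_min`. -/
theorem adjoint_restrictMax (hyp : Hypothesis a b p q r)
    {S : Submodule ℂ (maxDomain a b p q r)} (hS : minDomain hyp ≤ S) :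
    (restrictMax hyp S).adjoint = restrictMax hyp (boundaryCompl hyp S) := by
  have hdense := dense_restrictMax hyp hS
  refine le_antisymm ?_ (LinearPMap.IsFormalAdjoint.le_adjoint hdense ?_)
  · have key : ∀ y : (restrictMax hyp S).adjoint.domain, ∃ k ∈ boundaryCompl hyp S,
        (k : L2 a b r) = y ∧ maxOp hyp k = (restrictMax hyp S).adjoint y := fun y => by
      have hy : ∀ f ∈ S, ⟪(restrictMax hyp S).adjoint y, (f : L2 a b r)⟫_ℂ
          = ⟪(y : L2 a b r), maxOp hyp f⟫_ℂ := fun f hf =>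
        LinearPMap.adjoint_isFormalAdjoint hdense y ⟨f, f, hf, rfl⟩
      -- Testing on dom(H_min) alone already places y in dom(H_max); testing on all of S then yields
      -- only the boundary condition.
      obtain ⟨k, hk, hkH⟩ := exists_maxOp_eq_of_inner_eq hyp fun f hf => hy f (hS hf)
      refine ⟨k, fun f hf => ?_, hk, hkH⟩
      rw [← inner_maxOp_eq_inner_maxOp_iff, hkH, hk, hy f hf]
    refine ⟨fun y hy => ?_, fun y z hyz => ?_⟩
    · obtain ⟨k, hk, hky, -⟩ := key ⟨y, hy⟩
      exact ⟨k, hk, hky⟩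
    · obtain ⟨k, hk, hky, hkH⟩ := key y
      obtain ⟨z, hz⟩ := z
      obtain rfl : (k : L2 a b r) = z := hky.trans hyz
      rw [← hkH, restrictMax_apply]
  · rintro ⟨-, f, hf, rfl⟩ ⟨-, g, hg, rfl⟩
    exact ((inner_maxOp_eq_inner_maxOp_iff hyp f g).2 (boundaryForm_eq_zero_symm hyp (hg f hf)))

lemma isSelfAdjoint_restrictMax_iff (hyp : Hypothesis a b p q r)
    {S : Submodule ℂ (maxDomain a b p q r)} (hS : minDomain hyp ≤ S) :
    IsSelfAdjoint (restrictMax hyp S) ↔ boundaryCompl hyp S = S := by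
  rw [LinearPMap.isSelfAdjoint_def, adjoint_restrictMax hyp hS, restrictMax_inj]

lemma Hmin_eq (hyp : Hypothesis a b p q r) : Hmin hyp = restrictMax hyp (minDomain hyp) := by
  rw [Hmin, restrictMax_inj]
  ext f
  rw [mem_minDomain_iff]
  simp [gammaD, gammaN]
  tauto

/-- Every self-adjoint extension of `H_min` is a restriction of `H_max`. -/
lemma exists_eq_restrictMax_of_isSelfAdjoint (hyp : Hypothesis a b p q r)
    {H : L2 a b r →ₗ.[ℂ] L2 a b r} (hle : Hmin hyp ≤ H) (hH : IsSelfAdjoint H) :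
    ∃ S, minDomain hyp ≤ S ∧ boundaryCompl hyp S = S ∧ H = restrictMax hyp S := by
  rw [Hmin_eq] at hle
  have hd := dense_restrictMax hyp (le_refl (minDomain hyp))
  -- H_min ⊆ H = H* gives H ⊆ H_min*, which is a restriction of H_max.
  have h : H ≤ (restrictMax hyp (minDomain hyp)).adjoint := by
    refine LinearPMap.IsFormalAdjoint.le_adjoint hd fun x y => ?_
    have h₁ := LinearPMap.adjoint_isFormalAdjoint hH.dense_domain
    rw [LinearPMap.isSelfAdjoint_def.1 hH] at h₁
    have h₂ := h₁ ⟨x, hle.1 x.2⟩ y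
    rwa [← hle.2 (x := x) (y := ⟨x, hle.1 x.2⟩) rfl] at h₂
  rw [adjoint_restrictMax hyp le_rfl] at h
  obtain ⟨S, rfl⟩ := exists_eq_restrictMax hyp h
  have hS := (restrictMax_le_iff hyp).1 hle
  exact ⟨S, hS, (isSelfAdjoint_restrictMax_iff hyp hS).1 hH, rfl⟩

/-! ### The boundary condition given by a unitary matrix -/

/-- The subspace `{g | (γ_D - i γ_N) g = U (γ_D + i γ_N) g}` of `dom(H_max)`. -/
def cayleyDomain (hyp : Hypothesis a b p q r) (U : Matrix (Fin 2) (Fin 2) ℂ) :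
    Submodule ℂ (maxDomain a b p q r) :=
  LinearMap.ker (gammaMinus hyp - U.mulVecLin ∘ₗ gammaPlus hyp)

lemma mem_cayleyDomain (hyp : Hypothesis a b p q r) {U : Matrix (Fin 2) (Fin 2) ℂ}
    {f : maxDomain a b p q r} :
    f ∈ cayleyDomain hyp U ↔ gammaMinus hyp f = U.mulVec (gammaPlus hyp f) := by
  rw [cayleyDomain, LinearMap.mem_ker, LinearMap.sub_apply, sub_eq_zero]
  rfl

lemma minDomain_le_cayleyDomain (hyp : Hypothesis a b p q r) (U : Matrix (Fin 2) (Fin 2) ℂ) :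
    minDomain hyp ≤ cayleyDomain hyp U := fun f hf => by
  obtain ⟨hD, hN⟩ := (mem_minDomain hyp).1 hf
  simp [mem_cayleyDomain, gammaMinus_apply, gammaPlus_apply, hD, hN]

lemma cayleyDomain_injective (hyp : Hypothesis a b p q r) :
    Function.Injective (cayleyDomain hyp) := by
  intro U V h
  refine Matrix.ext_of_mulVec_single fun i => ?_
  obtain ⟨g, hs, hd⟩ := exists_gammaPlus_eq hyp (Pi.single i 1) (U.mulVec (Pi.single i 1))
  have hg : g ∈ cayleyDomain hyp U := (mem_cayleyDomain hyp).2 (by rw [hs, hd])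
  rw [h, mem_cayleyDomain, hs, hd] at hg
  exact hg

/-- Multiplying i(U − I)γ_D = (U + I)γ_N by ±i and regrouping gives γ_D − iγ_N = U(γ_D + iγ_N). -/
lemma HU_eq (hyp : Hypothesis a b p q r) (U : Matrix (Fin 2) (Fin 2) ℂ) :
    HU hyp U = restrictMax hyp (cayleyDomain hyp U) := by
  rw [HU, restrictMax_inj]
  ext f
  rw [mem_cayleyDomain, gammaMinus_apply, gammaPlus_apply]
  change _ = _ ↔ _
  rw [Matrix.mulVec_add, Matrix.mulVec_smul, Matrix.smul_mulVec, Matrix.sub_mulVec,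
    Matrix.add_mulVec, Matrix.one_mulVec, Matrix.one_mulVec]
  have hI := Complex.I_mul_I
  constructor <;> intro h <;> ext i <;> have h := congrFun h i <;>
    simp only [Pi.add_apply, Pi.sub_apply, Pi.smul_apply, smul_eq_mul] at h ⊢
  · linear_combination Complex.I * h + (-U.mulVec (gammaD hyp f) i + gammaD hyp f i) * hI
  · linear_combination (-Complex.I) * h - (U.mulVec (gammaN hyp f) i + gammaN hyp f i) * hI

lemma boundaryCompl_cayleyDomain (hyp : Hypothesis a b p q r) {U : Matrix (Fin 2) (Fin 2) ℂ}
    (hU : U ∈ Matrix.unitaryGroup (Fin 2) ℂ) :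
    boundaryCompl hyp (cayleyDomain hyp U) = cayleyDomain hyp U := by
  have h₁ : U.conjTranspose * U = 1 := Matrix.mem_unitaryGroup_iff'.1 hU
  have h₂ : U * U.conjTranspose = 1 := Matrix.mem_unitaryGroup_iff.1 hU
  have hform : ∀ g, ∀ f ∈ cayleyDomain hyp U, boundaryForm hyp g f =
      star (gammaPlus hyp g - U.conjTranspose.mulVec (gammaMinus hyp g)) ⬝ᵥ gammaPlus hyp f := by
    intro g f hf
    rw [boundaryForm, (mem_cayleyDomain hyp).1 hf, star_sub, sub_dotProduct, Matrix.star_mulVec,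
      Matrix.conjTranspose_conjTranspose, Matrix.dotProduct_mulVec]
  ext g
  rw [mem_cayleyDomain]
  constructor
  · intro hg
    set z := gammaPlus hyp g - U.conjTranspose.mulVec (gammaMinus hyp g)
    -- Testing g against an element of the domain with γ_+ f = z turns the form into ‖z‖², so z = 0.
    obtain ⟨f, hs, hd⟩ := exists_gammaPlus_eq hyp z (U.mulVec z)
    have hf : f ∈ cayleyDomain hyp U := (mem_cayleyDomain hyp).2 (by rw [hs, hd])
    have h := hg f hf
    rw [hform g f hf, hs, dotProduct_star_self_eq_zero, sub_eq_zero] at h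
    rw [h, Matrix.mulVec_mulVec, h₂, Matrix.one_mulVec]
  · intro hg f hf
    rw [hform g f hf, hg, Matrix.mulVec_mulVec, h₁, Matrix.one_mulVec, sub_self, star_zero,
      zero_dotProduct]

/-- Subspaces that agree with their complement are given by unitary matrices. -/
theorem exists_eq_cayleyDomain (hyp : Hypothesis a b p q r)
    {S : Submodule ℂ (maxDomain a b p q r)} (hmin : minDomain hyp ≤ S)
    (hS : boundaryCompl hyp S = S) :
    ∃ U ∈ Matrix.unitaryGroup (Fin 2) ℂ, S = cayleyDomain hyp U := by
  have hiso : ∀ f ∈ S, ∀ g ∈ S, star (gammaPlus hyp f) ⬝ᵥ gammaPlus hyp g =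
      star (gammaMinus hyp f) ⬝ᵥ gammaMinus hyp g := fun f hf g hg => by
    rw [← hS] at hf
    exact sub_eq_zero.1 (hf g hg)
  have htop : S.map (gammaPlus hyp) = ⊤ := by
    by_contra hne
    obtain ⟨φ, hφ, hle⟩ := Submodule.exists_le_ker_of_lt_top _ (lt_top_iff_ne_top.2 hne)
    let z : Fin 2 → ℂ := fun i => φ (Pi.single i 1)
    have hφz : ∀ c, φ c = z ⬝ᵥ c := fun c => by
      conv_lhs => rw [← Finset.univ_sum_single c, map_sum]
      refine Finset.sum_congr rfl fun i _ => ?_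
      rw [mul_comm, ← smul_eq_mul, ← map_smul, ← Pi.single_smul, smul_eq_mul, mul_one]
    -- With γ_- g = 0 and γ_+ g orthogonal to γ_+ S, g lies in the complement of S, hence in S; then
    -- γ_+ g is orthogonal to itself and φ = 0.
    obtain ⟨g, hs, hd⟩ := exists_gammaPlus_eq hyp (star z) 0
    have hg : g ∈ S := by
      rw [← hS]
      intro f hf
      have h : φ (gammaPlus hyp f) = 0 := hle ⟨f, hf, rfl⟩
      rw [boundaryForm, hs, hd, star_star, ← hφz, h, star_zero, zero_dotProduct, sub_zero]
    have h : φ (gammaPlus hyp g) = 0 := hle ⟨g, hg, rfl⟩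
    rw [hφz, hs, dotProduct_self_star_eq_zero] at h
    exact hφ (LinearMap.ext fun c => by rw [hφz, h, zero_dotProduct, LinearMap.zero_apply])
  have hex : ∀ i : Fin 2, ∃ f ∈ S, gammaPlus hyp f = Pi.single i 1 := fun i => by
    have : (Pi.single i 1 : Fin 2 → ℂ) ∈ S.map (gammaPlus hyp) := htop ▸ Submodule.mem_top
    exact this
  choose F hFS hF using hex
  let U : Matrix (Fin 2) (Fin 2) ℂ := Matrix.of fun i j => gammaMinus hyp (F j) i
  let L : (Fin 2 → ℂ) → maxDomain a b p q r := fun c => ∑ j, c j • F j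
  have hLS : ∀ c, L c ∈ S := fun c => S.sum_mem fun j _ => S.smul_mem _ (hFS j)
  have hLp : ∀ c, gammaPlus hyp (L c) = c := fun c => by
    simp only [L, map_sum, map_smul, hF]
    exact (pi_eq_sum_univ' c).symm
  have hLm : ∀ c, gammaMinus hyp (L c) = U.mulVec c := fun c => by
    ext i
    simp [L, U, Matrix.mulVec, dotProduct, mul_comm]
  refine ⟨U, ?_, ?_⟩
  · rw [Matrix.mem_unitaryGroup_iff']
    ext i j
    have h := hiso _ (hFS i) _ (hFS j)
    rw [hF, hF, dotProduct_single_one, Pi.star_apply] at h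
    rw [Matrix.star_eq_conjTranspose, Matrix.one_apply, Matrix.mul_apply]
    refine h.symm.trans ?_
    simp [Pi.single_apply, eq_comm]
  · ext f
    rw [mem_cayleyDomain]
    constructor
    · intro hf
      have hsub := S.sub_mem hf (hLS (gammaPlus hyp f))
      -- The difference has γ_+ = 0, so the isometry forces γ_- = 0 as well.
      have h := hiso _ hsub _ hsub
      rw [map_sub, hLp, sub_self, dotProduct_zero, eq_comm,
        dotProduct_star_self_eq_zero, map_sub, hLm, sub_eq_zero] at h
      exact h
    · intro hf
      have hm : f - L (gammaPlus hyp f) ∈ minDomain hyp :=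
        mem_minDomain_of_gammaPlus hyp (by rw [map_sub, hLp, sub_self])
          (by rw [map_sub, hLm, hf, sub_self])
      simpa using S.add_mem (hmin hm) (hLS (gammaPlus hyp f))

/-! ### Matrix algebra of admissible pairs -/

lemma isUnit_of_rank_eq {n : Type*} [Fintype n] [DecidableEq n] {A : Matrix n n ℂ}
    (h : A.rank = Fintype.card n) : IsUnit A := by
  rw [← Matrix.mulVec_surjective_iff_isUnit]
  have : LinearMap.range A.mulVecLin = ⊤ :=
    Submodule.eq_top_of_finrank_eq (by rw [Module.finrank_fintype_fun_eq_card]; exact h)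
  exact LinearMap.range_eq_top.1 this

variable {XD XN : Matrix (Fin 2) (Fin 2) ℂ}

lemma Admissible.mul_conjTranspose_add (h : Admissible XD XN) :
    (XD + Complex.I • XN) * (XD + Complex.I • XN).conjTranspose =
      XD * XD.conjTranspose + XN * XN.conjTranspose := by
  simp only [Matrix.conjTranspose_add, Matrix.conjTranspose_smul, Complex.star_def,
    Complex.conj_I, add_mul, mul_add, Matrix.smul_mul, Matrix.mul_smul, h.2, smul_smul]
  rw [show -Complex.I * Complex.I = 1 by simp, one_smul, neg_smul]
  abel

lemma Admissible.mul_conjTranspose_sub (h : Admissible XD XN) :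
    (Complex.I • XN - XD) * (Complex.I • XN - XD).conjTranspose =
      XD * XD.conjTranspose + XN * XN.conjTranspose := by
  simp only [Matrix.conjTranspose_sub, Matrix.conjTranspose_smul, Complex.star_def,
    Complex.conj_I, sub_mul, mul_sub, Matrix.smul_mul, Matrix.mul_smul, h.2, smul_smul]
  rw [show -Complex.I * Complex.I = 1 by simp, one_smul, neg_smul]
  abel

/-- With A = X_D + iX_N, the product AA* is the Gram matrix (X_D X_N)(X_D X_N)*, since (*) cancels
the cross terms; it has the rank of (X_D X_N). -/
lemma Admissible.isUnit (h : Admissible XD XN) : IsUnit (XD + Complex.I • XN) := by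
  have h₁ : ((XD + Complex.I • XN) * (XD + Complex.I • XN).conjTranspose).rank = 2 := by
    rw [h.mul_conjTranspose_add, ← Matrix.fromCols_mul_fromRows,
      ← Matrix.conjTranspose_fromCols_eq_fromRows_conjTranspose,
      Matrix.rank_self_mul_conjTranspose, h.1]
  rw [Matrix.rank_self_mul_conjTranspose] at h₁
  exact isUnit_of_rank_eq h₁

lemma Admissible.UX_mem_unitaryGroup (h : Admissible XD XN) :
    UX XD XN ∈ Matrix.unitaryGroup (Fin 2) ℂ := by
  have hA := (Matrix.isUnit_iff_isUnit_det _).1 h.isUnit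
  rw [Matrix.mem_unitaryGroup_iff, Matrix.star_eq_conjTranspose, UX, Matrix.conjTranspose_mul,
    Matrix.mul_assoc, ← Matrix.mul_assoc (Complex.I • XN - XD), h.mul_conjTranspose_sub,
    ← h.mul_conjTranspose_add, Matrix.mul_assoc, ← Matrix.conjTranspose_mul,
    Matrix.nonsing_inv_mul _ hA, Matrix.conjTranspose_one, Matrix.mul_one,
    Matrix.nonsing_inv_mul _ hA]

lemma XDU_add_smul_XNU (U : Matrix (Fin 2) (Fin 2) ℂ) :
    XDU U + Complex.I • XNU U = Complex.I • 1 := by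
  simp only [XDU, XNU, smul_smul, smul_add, smul_sub]
  module

lemma smul_XNU_sub_XDU (U : Matrix (Fin 2) (Fin 2) ℂ) :
    Complex.I • XNU U - XDU U = Complex.I • U := by
  simp only [XDU, XNU, smul_smul, smul_add, smul_sub]
  module

lemma isUnit_XDU_add_smul_XNU (U : Matrix (Fin 2) (Fin 2) ℂ) :
    IsUnit (XDU U + Complex.I • XNU U) := by
  rw [XDU_add_smul_XNU, Matrix.isUnit_iff_isUnit_det]
  simp

lemma UX_XDU_XNU (U : Matrix (Fin 2) (Fin 2) ℂ) : UX (XDU U) (XNU U) = U := by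
  have h := (Matrix.isUnit_iff_isUnit_det _).1 (isUnit_XDU_add_smul_XNU U)
  rw [XDU_add_smul_XNU] at h
  rw [UX, smul_XNU_sub_XDU, XDU_add_smul_XNU,
    show Complex.I • U = (Complex.I • 1 : Matrix (Fin 2) (Fin 2) ℂ) * U by
      rw [Matrix.smul_mul, Matrix.one_mul],
    Matrix.nonsing_inv_mul_cancel_left _ _ h]

lemma admissible_XDU_XNU {U : Matrix (Fin 2) (Fin 2) ℂ}
    (hU : U ∈ Matrix.unitaryGroup (Fin 2) ℂ) : Admissible (XDU U) (XNU U) := by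
  constructor
  · refine le_antisymm (Matrix.rank_le_card_height _) ?_
    -- Multiplying by the column block (I, iI) produces X_D + iX_N = iI, of rank 2, which bounds the
    -- rank from below.
    have h := Matrix.rank_mul_le_left (Matrix.fromCols (XDU U) (XNU U))
      (Matrix.fromRows (1 : Matrix (Fin 2) (Fin 2) ℂ) (Complex.I • 1))
    rw [Matrix.fromCols_mul_fromRows, Matrix.mul_one, Matrix.mul_smul, Matrix.mul_one,
      Matrix.rank_of_isUnit _ (isUnit_XDU_add_smul_XNU U)] at h
    exact h
  · have h₂ : U * U.conjTranspose = 1 := Matrix.mem_unitaryGroup_iff.1 hU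
    simp only [XDU, XNU, Matrix.conjTranspose_smul, Matrix.conjTranspose_add,
      Matrix.conjTranspose_sub, Matrix.conjTranspose_one, Matrix.smul_mul, Matrix.mul_smul,
      sub_mul, mul_sub, add_mul, mul_add, one_mul, mul_one, h₂]
    simp
    module

/-- `H_{X_D, X_N} = H_U` for `U = (X_D + i X_N)⁻¹ (i X_N - X_D)`. -/
theorem HX_eq_HU_UX (hyp : Hypothesis a b p q r) (h : IsUnit (XD + Complex.I • XN)) :
    HX hyp XD XN = HU hyp (UX XD XN) := by
  have hA := (Matrix.isUnit_iff_isUnit_det _).1 h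
  rw [HU_eq, HX, restrictMax_inj]
  ext f
  rw [mem_cayleyDomain]
  change XD.mulVec _ + XN.mulVec _ = 0 ↔ _
  have h₁ : gammaMinus hyp f = (UX XD XN).mulVec (gammaPlus hyp f) ↔
      (XD + Complex.I • XN).mulVec (gammaMinus hyp f) =
        (Complex.I • XN - XD).mulVec (gammaPlus hyp f) := by
    rw [UX, ← Matrix.mulVec_mulVec]
    constructor <;> intro e
    · rw [e, Matrix.mulVec_mulVec, Matrix.mul_nonsing_inv _ hA, Matrix.one_mulVec]
    · rw [← e, Matrix.mulVec_mulVec, Matrix.nonsing_inv_mul _ hA, Matrix.one_mulVec]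
  have h₂ : (XD + Complex.I • XN).mulVec (gammaMinus hyp f) -
      (Complex.I • XN - XD).mulVec (gammaPlus hyp f) =
        (2 : ℂ) • (XD.mulVec (gammaD hyp f) + XN.mulVec (gammaN hyp f)) := by
    simp only [gammaMinus_apply, gammaPlus_apply, Matrix.add_mulVec, Matrix.sub_mulVec,
      Matrix.mulVec_add, Matrix.mulVec_sub, Matrix.smul_mulVec, Matrix.mulVec_smul, smul_smul,
      smul_add, smul_sub, Complex.I_mul_I]
    module
  rw [h₁, ← sub_eq_zero (a := Matrix.mulVec _ (gammaMinus hyp f)), h₂,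
    smul_eq_zero_iff_right two_ne_zero]

/-! ### Classification of the self-adjoint extensions -/

lemma Hmin_le_HU (hyp : Hypothesis a b p q r) (U : Matrix (Fin 2) (Fin 2) ℂ) :
    Hmin hyp ≤ HU hyp U := by
  rw [Hmin_eq, HU_eq, restrictMax_le_iff]
  exact minDomain_le_cayleyDomain hyp U

theorem isSelfAdjoint_HU (hyp : Hypothesis a b p q r) {U : Matrix (Fin 2) (Fin 2) ℂ}
    (hU : U ∈ Matrix.unitaryGroup (Fin 2) ℂ) : IsSelfAdjoint (HU hyp U) := by
  rw [HU_eq, isSelfAdjoint_restrictMax_iff hyp (minDomain_le_cayleyDomain hyp U)]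
  exact boundaryCompl_cayleyDomain hyp hU

theorem exists_eq_HU_of_isSelfAdjoint (hyp : Hypothesis a b p q r)
    {H : L2 a b r →ₗ.[ℂ] L2 a b r} (hle : Hmin hyp ≤ H) (hH : IsSelfAdjoint H) :
    ∃ U ∈ Matrix.unitaryGroup (Fin 2) ℂ, H = HU hyp U := by
  obtain ⟨S, hmin, hS, rfl⟩ := exists_eq_restrictMax_of_isSelfAdjoint hyp hle hH
  obtain ⟨U, hU, rfl⟩ := exists_eq_cayleyDomain hyp hmin hS
  exact ⟨U, hU, (HU_eq hyp U).symm⟩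

lemma HU_injective (hyp : Hypothesis a b p q r) : Function.Injective (HU hyp) := by
  intro U V h
  rw [HU_eq, HU_eq, restrictMax_inj] at h
  exact cayleyDomain_injective hyp h

end SturmLiouville

end

theorem mainTheorem11 (a b : ℝ) (p q r : ℝ → ℝ) (hyp : SturmLiouville.Hypothesis a b p q r) :
    -- (i) a symmetric extension of `H_min` is self-adjoint iff it is some `H_U`, `U` unitary
    (∀ H : SturmLiouville.L2 a b r →ₗ.[ℂ] SturmLiouville.L2 a b r,
      SturmLiouville.Hmin hyp ≤ H → SturmLiouville.IsSymmetricOp H →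
        (IsSelfAdjoint H ↔
          ∃ U ∈ Matrix.unitaryGroup (Fin 2) ℂ, H = SturmLiouville.HU hyp U)) ∧
    -- (ii) conversion from `U` to `(X_D, X_N)`, and recovery of `U`
    (∀ U ∈ Matrix.unitaryGroup (Fin 2) ℂ,
      SturmLiouville.Admissible (SturmLiouville.XDU U) (SturmLiouville.XNU U) ∧
      SturmLiouville.HU hyp U =
        SturmLiouville.HX hyp (SturmLiouville.XDU U) (SturmLiouville.XNU U) ∧
      IsUnit (SturmLiouville.XDU U + Complex.I • SturmLiouville.XNU U) ∧
      U = SturmLiouville.UX (SturmLiouville.XDU U) (SturmLiouville.XNU U)) ∧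
    -- (iii) conversion from `(X_D, X_N)` to `U`
    (∀ XD XN : Matrix (Fin 2) (Fin 2) ℂ, SturmLiouville.Admissible XD XN →
      SturmLiouville.Hmin hyp ≤ SturmLiouville.HX hyp XD XN ∧
      IsSelfAdjoint (SturmLiouville.HX hyp XD XN) ∧
      IsUnit (XD + Complex.I • XN) ∧
      SturmLiouville.UX XD XN ∈ Matrix.unitaryGroup (Fin 2) ℂ ∧
      SturmLiouville.HX hyp XD XN = SturmLiouville.HU hyp (SturmLiouville.UX XD XN)) ∧
    -- (iv) uniqueness of `U`, and bijectivity of `U ↦ H_U` onto the self-adjoint extensions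
    (∀ U ∈ Matrix.unitaryGroup (Fin 2) ℂ, ∀ U' ∈ Matrix.unitaryGroup (Fin 2) ℂ,
      (SturmLiouville.HU hyp U = SturmLiouville.HU hyp U' ↔ U = U')) ∧
    Set.BijOn (SturmLiouville.HU hyp)
      (Matrix.unitaryGroup (Fin 2) ℂ : Set (Matrix (Fin 2) (Fin 2) ℂ))
      {H | SturmLiouville.Hmin hyp ≤ H ∧ IsSelfAdjoint H} := by
  refine ⟨fun H hle _ => ⟨fun hH => SturmLiouville.exists_eq_HU_of_isSelfAdjoint hyp hle hH, ?_⟩,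
    fun U hU => ⟨SturmLiouville.admissible_XDU_XNU hU, ?_,
      SturmLiouville.isUnit_XDU_add_smul_XNU U, (SturmLiouville.UX_XDU_XNU U).symm⟩,
    fun XD XN h => ?_,
    fun U _ U' _ => (SturmLiouville.HU_injective hyp).eq_iff,
    fun U hU => ⟨SturmLiouville.Hmin_le_HU hyp U, SturmLiouville.isSelfAdjoint_HU hyp hU⟩,
    (SturmLiouville.HU_injective hyp).injOn, fun H hH => ?_⟩
  · rintro ⟨U, hU, rfl⟩
    exact SturmLiouville.isSelfAdjoint_HU hyp hU
  · rw [SturmLiouville.HX_eq_HU_UX hyp (SturmLiouville.isUnit_XDU_add_smul_XNU U),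
      SturmLiouville.UX_XDU_XNU]
  · rw [SturmLiouville.HX_eq_HU_UX hyp h.isUnit]
    exact ⟨SturmLiouville.Hmin_le_HU hyp _,
      SturmLiouville.isSelfAdjoint_HU hyp h.UX_mem_unitaryGroup, h.isUnit,
      h.UX_mem_unitaryGroup, rfl⟩
  · obtain ⟨U, hU, rfl⟩ := SturmLiouville.exists_eq_HU_of_isSelfAdjoint hyp hH.1 hH.2
    exact ⟨U, hU, rfl⟩
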